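/- Let $n\ge 0$ be an integer and let $Q_n$ be the $n$-dimensional hypercube: its vertices are the subsets of $[n]=\{1,\dots,n\}$, and $x,y$ are adjacent if and only if $|x\triangle y|=1$. Every integer $x$ with $1\le x<2^n$ can be written uniquely as $$x=\sum_{i=0}^{k}\binom{n}{i}+\alpha\binom{n}{k+1},\qquad k\in\{0,\dots,n-1\},\quad 0\le\alpha<1,$$ and one sets $$s(x)=s_n(x)=(1-\alpha)\binom{n}{k}+\alpha\binom{n}{k+1};$$ also put $s(0)=0$. If $A$ is a set of vertices of $Q_n$ with $|A|\le 2^{n-1}$, then there is a matching from $A$ to its complement $A^c$ of size at least $s(|A|)$; that is, there are at least $s(|A|)$ pairwise disjoint edges of $Q_n$, each having one endpoint in $A$ and the other in $A^c$. -/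

import Mathlib

open scoped symmDiff

/-- The hypercube `Q_n`: its vertices are the subsets of an `n`-element set, and `x`, `y` are
adjacent when their symmetric difference has exactly one element. -/
def hypercube (n : ℕ) : SimpleGraph (Finset (Fin n)) where
  Adj x y := (x ∆ y).card = 1
  symm := ⟨fun x y h => by rwa [symmDiff_comm]⟩
  loopless := ⟨fun x h => by simp at h⟩

/-- The number `∑_{i=0}^k (n choose i)` of subsets of size at most `k` of an `n`-element set. -/
def ballSize (n k : ℕ) : ℕ := ∑ i ∈ Finset.range (k + 1), n.choose i

/-- For `1 ≤ x < 2 ^ n`: the unique `k < n` with `ballSize n k ≤ x < ballSize n (k + 1)`. -/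
noncomputable def levelIndex (n : ℕ) (x : ℝ) : ℕ :=
  Nat.findGreatest (fun k => (ballSize n k : ℝ) ≤ x) n

/-- The number `α ∈ [0, 1)` with `x = ballSize n k + α (n choose (k + 1))`, `k = levelIndex n x`. -/
noncomputable def levelFraction (n : ℕ) (x : ℝ) : ℝ :=
  (x - ballSize n (levelIndex n x)) / n.choose (levelIndex n x + 1)

/-- The interpolated surface-size function `s_n`: if `x = ∑_{i=0}^k (n choose i) +
α (n choose (k + 1))` with `0 ≤ α < 1`, then `s_n(x) = (1 - α) (n choose k) +
α (n choose (k + 1))`. For `0 ≤ x < 1` this is read with `k = -1`, i.e. `α = x` and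
`(n choose -1) = 0`, so that `s_n(x) = x` there; in particular `s_n(0) = 0`. -/
noncomputable def surfaceSize (n : ℕ) (x : ℝ) : ℝ :=
  if x < 1 then x
  else (1 - levelFraction n x) * n.choose (levelIndex n x)
    + levelFraction n x * n.choose (levelIndex n x + 1)

/-! Write `a = |A|`, `x = |X|`. By the defect form of Hall's theorem it suffices that every `X ⊆ A`
has at least `s(a) - (a - x)` neighbours outside `A`. The isoperimetric bound
`ballGrowth_card_le_card_closedNeighbors` puts at least `ballGrowth n x` vertices within distance
one of a nonempty `X`, and at most `a` of them lie in `A`. What remains is `s(a) ≤ max (a - x)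
(ballGrowth n x - x)`, which is `surfaceSize_le_max`. Let `b` be the interpolated ball size one
radius below `a`, so that `ballGrowth n b = a` and `a - b = s(a)`. If `x ≤ b`, the first term
suffices. On `[b, a]` the second term is concave and at least `s(a)` at both ends; the end `a` is
where `a ≤ 2^(n-1)` enters. -/

/-! ### Binomial sums and the concave growth function. -/

/-- The number of subsets of size less than `k` of an `n`-element set. -/
def chooseSum (n k : ℕ) : ℝ := ∑ i ∈ Finset.range k, (n.choose i : ℝ)

/-- The ratio `(n choose (k + 1)) / (n choose k)`. -/
noncomputable def chooseRatio (n k : ℕ) : ℝ := (n + 1) / (k + 1) - 1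

/-- The affine function taking `chooseSum n k` to `chooseSum n (k + 1)` and
`chooseSum n (k + 1)` to `chooseSum n (k + 2)`. -/
noncomputable def affinePiece (n k : ℕ) (x : ℝ) : ℝ :=
  chooseSum n (k + 1) + (x - chooseSum n k) * chooseRatio n k

/-- The concave piecewise affine function taking `chooseSum n k` to `chooseSum n (k + 1)`. -/
noncomputable def ballGrowth (n : ℕ) (x : ℝ) : ℝ :=
  (Finset.range (n + 1)).inf' Finset.nonempty_range_add_one (fun k => affinePiece n k x)

lemma chooseSum_zero (n : ℕ) : chooseSum n 0 = 0 := by simp [chooseSum]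

lemma chooseSum_one (n : ℕ) : chooseSum n 1 = 1 := by simp [chooseSum]

lemma chooseSum_succ (n k : ℕ) : chooseSum n (k + 1) = chooseSum n k + n.choose k := by
  simp [chooseSum, Finset.sum_range_succ]

lemma chooseSum_succ_succ (n k : ℕ) :
    chooseSum (n + 1) (k + 1) = chooseSum n (k + 1) + chooseSum n k := by
  induction k with
  | zero => simp [chooseSum]
  | succ k ih =>
    rw [chooseSum_succ (n + 1) (k + 1), ih, chooseSum_succ n (k + 1), chooseSum_succ n k,
      Nat.choose_succ_succ]
    push_cast
    ring

lemma chooseSum_mono (n : ℕ) : Monotone (chooseSum n) :=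
  monotone_nat_of_le_succ fun k => by
    rw [chooseSum_succ]
    exact le_add_of_nonneg_right (Nat.cast_nonneg _)

lemma chooseSum_add_one_eq (n : ℕ) : chooseSum n (n + 1) = 2 ^ n := by
  unfold chooseSum
  exact_mod_cast Nat.sum_range_choose n

lemma chooseSum_nonneg (n k : ℕ) : 0 ≤ chooseSum n k := by
  unfold chooseSum
  positivity

lemma ballSize_eq_chooseSum (n k : ℕ) : (ballSize n k : ℝ) = chooseSum n (k + 1) := by
  simp [ballSize, chooseSum]

lemma chooseSum_add_chooseSum (n k : ℕ) (hk : k ≤ n + 1) :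
    chooseSum n k + chooseSum n (n + 1 - k) = 2 ^ n := by
  induction k with
  | zero => simp [chooseSum_zero, chooseSum_add_one_eq]
  | succ k ih =>
    have h := ih (by omega)
    have e : n + 1 - k = (n + 1 - (k + 1)) + 1 := by omega
    have hs : n.choose (n + 1 - (k + 1)) = n.choose k := by
      rw [show n + 1 - (k + 1) = n - k by omega, Nat.choose_symm (by omega)]
    rw [e, chooseSum_succ, hs] at h
    rw [chooseSum_succ]
    linarith

lemma choose_succ_eq_mul_chooseRatio (n k : ℕ) :
    (n.choose (k + 1) : ℝ) = n.choose k * chooseRatio n k := by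
  have hk : (k : ℝ) + 1 ≠ 0 := by positivity
  have h : (n.choose (k + 1) : ℝ) * (k + 1) = n.choose k * (n - k) := by
    rcases le_or_gt k n with hkn | hkn
    · have := Nat.choose_succ_right_eq n k
      rw [← Nat.cast_sub hkn]
      exact_mod_cast this
    · rw [Nat.choose_eq_zero_of_lt hkn, Nat.choose_eq_zero_of_lt (by omega)]
      simp
  unfold chooseRatio
  field_simp
  linarith

lemma chooseRatio_antitone (n : ℕ) : Antitone (chooseRatio n) := by
  intro i j hij
  unfold chooseRatio
  gcongr

lemma chooseRatio_nonneg {n k : ℕ} (hk : k ≤ n) : 0 ≤ chooseRatio n k := by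
  have h := chooseRatio_antitone n hk
  have : chooseRatio n n = 0 := by
    unfold chooseRatio
    rw [div_self (by positivity), sub_self]
  linarith

/-- The slopes `chooseRatio n i` decrease in `i`, so each chord, extended as a line, stays above the
other nodes. Hence the minimum of the lines interpolates the nodes. -/
lemma chooseSum_succ_le_affinePiece (n i j : ℕ) :
    chooseSum n (i + 1) ≤ affinePiece n j (chooseSum n i) := by
  have step (i : ℕ) : affinePiece n j (chooseSum n (i + 1)) =
      affinePiece n j (chooseSum n i) + n.choose i * chooseRatio n j := by
    rw [chooseSum_succ n i]
    unfold affinePiece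
    ring
  have hc (i : ℕ) : (0 : ℝ) ≤ n.choose i := Nat.cast_nonneg _
  rcases le_total j i with hij | hij
  · induction i, hij using Nat.le_induction with
    | base => simp [affinePiece]
    | succ i hij ih =>
      rw [step, chooseSum_succ n (i + 1), choose_succ_eq_mul_chooseRatio]
      have := mul_le_mul_of_nonneg_left (chooseRatio_antitone n hij) (hc i)
      linarith
  · induction hij using Nat.decreasingInduction with
    | self => simp [affinePiece]
    | of_succ i hij ih =>
      rw [step, chooseSum_succ n (i + 1), choose_succ_eq_mul_chooseRatio] at ih
      have := mul_le_mul_of_nonneg_left (chooseRatio_antitone n hij.le) (hc i)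
      linarith

lemma ballGrowth_le_affinePiece {n k : ℕ} (hk : k ≤ n) (x : ℝ) :
    ballGrowth n x ≤ affinePiece n k x :=
  Finset.inf'_le _ (Finset.mem_range.2 (by omega))

lemma ballGrowth_mono (n : ℕ) : Monotone (ballGrowth n) := by
  intro x y hxy
  refine Finset.le_inf' _ _ fun k hk => ?_
  have hk : k ≤ n := by simpa [Nat.lt_succ_iff] using hk
  refine (ballGrowth_le_affinePiece hk x).trans ?_
  have := mul_le_mul_of_nonneg_right hxy (chooseRatio_nonneg hk)
  unfold affinePiece
  linarith

lemma ballGrowth_concaveOn (n : ℕ) : ConcaveOn ℝ Set.univ (ballGrowth n) := by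
  refine ⟨convex_univ, fun x _ y _ a b ha hb hab => ?_⟩
  refine Finset.le_inf' _ _ fun k hk => ?_
  have hk : k ≤ n := by simpa [Nat.lt_succ_iff] using hk
  have hx := mul_le_mul_of_nonneg_left (ballGrowth_le_affinePiece hk x) ha
  have hy := mul_le_mul_of_nonneg_left (ballGrowth_le_affinePiece hk y) hb
  have e : affinePiece n k (a • x + b • y) = a * affinePiece n k x + b * affinePiece n k y := by
    obtain rfl : b = 1 - a := by linarith
    simp only [affinePiece, smul_eq_mul]
    ring
  rw [e, smul_eq_mul, smul_eq_mul]
  linarith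

lemma ballGrowth_interpolate (n k : ℕ) {α : ℝ} (h0 : 0 ≤ α) (h1 : α ≤ 1) :
    ballGrowth n (chooseSum n k + α * n.choose k) =
      chooseSum n (k + 1) + α * n.choose (k + 1) := by
  refine le_antisymm ?_ (Finset.le_inf' _ _ fun j _ => ?_)
  · rcases le_or_gt k n with hk | hk
    · refine (ballGrowth_le_affinePiece hk _).trans_eq ?_
      rw [choose_succ_eq_mul_chooseRatio]
      unfold affinePiece
      ring
    · refine (ballGrowth_le_affinePiece le_rfl _).trans ?_
      have hr : chooseRatio n n = 0 := by
        unfold chooseRatio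
        rw [div_self (by positivity), sub_self]
      have := chooseSum_mono n (show n + 1 ≤ k + 1 by omega)
      have h2 : (0 : ℝ) ≤ α * n.choose (k + 1) := by positivity
      rw [affinePiece, hr]
      linarith
  · have e : affinePiece n j (chooseSum n k + α * n.choose k) =
        (1 - α) * affinePiece n j (chooseSum n k) +
          α * affinePiece n j (chooseSum n (k + 1)) := by
      rw [chooseSum_succ n k]
      unfold affinePiece
      ring
    have ha := mul_le_mul_of_nonneg_left (chooseSum_succ_le_affinePiece n k j) (sub_nonneg.2 h1)
    have hb := mul_le_mul_of_nonneg_left (chooseSum_succ_le_affinePiece n (k + 1) j) h0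
    rw [chooseSum_succ n (k + 1)] at hb
    rw [e]
    linarith

lemma ballGrowth_zero (n : ℕ) : ballGrowth n 0 = 1 := by
  simpa [chooseSum_zero, chooseSum_one] using ballGrowth_interpolate n 0 le_rfl zero_le_one

lemma ConcaveOn.add_le_add_of_spread {f : ℝ → ℝ} (hf : ConcaveOn ℝ Set.univ f)
    {x₀ x₁ y₀ y₁ : ℝ} (hsum : x₀ + x₁ = y₀ + y₁) (h₁ : y₁ ≤ x₁) (h₀ : x₁ ≤ y₀) :
    f y₀ + f y₁ ≤ f x₀ + f x₁ := by
  rcases (h₁.trans h₀).eq_or_lt with h | h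
  · obtain rfl : x₁ = y₁ := by linarith
    obtain rfl : x₀ = y₀ := by linarith
    rfl
  · have hd : 0 < y₀ - y₁ := sub_pos.2 h
    set t := (x₁ - y₁) / (y₀ - y₁) with ht
    have ht0 : 0 ≤ t := div_nonneg (by linarith) hd.le
    have ht1 : t ≤ 1 := (div_le_one hd).2 (by linarith)
    have htd : t * (y₀ - y₁) = x₁ - y₁ := div_mul_cancel₀ _ hd.ne'
    have e1 : t • y₀ + (1 - t) • y₁ = x₁ := by simp only [smul_eq_mul]; linarith
    have e0 : (1 - t) • y₀ + t • y₁ = x₀ := by simp only [smul_eq_mul]; linarith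
    have c1 := hf.2 (Set.mem_univ y₀) (Set.mem_univ y₁) ht0 (sub_nonneg.2 ht1) (by ring)
    have c0 := hf.2 (Set.mem_univ y₀) (Set.mem_univ y₁) (sub_nonneg.2 ht1) ht0 (by ring)
    rw [e1] at c1
    rw [e0] at c0
    simp only [smul_eq_mul] at c0 c1
    linarith

/-! ### The numerical induction step for isoperimetry. -/

lemma exists_chooseSum_interpolate (n m : ℕ) {x : ℝ} (h1 : 1 ≤ x) (h2 : x ≤ chooseSum n (m + 1)) :
    ∃ (k : ℕ) (α : ℝ), 0 ≤ α ∧ α ≤ 1 ∧ x = chooseSum n (k + 1) + α * n.choose (k + 1) := by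
  induction m with
  | zero =>
    rw [zero_add, chooseSum_one] at h2
    exact ⟨0, 0, le_rfl, zero_le_one, by rw [zero_add, chooseSum_one]; linarith⟩
  | succ m ih =>
    rcases le_or_gt x (chooseSum n (m + 1)) with h | h
    · exact ih h
    · rw [chooseSum_succ] at h2
      have hc : (0 : ℝ) < n.choose (m + 1) := by linarith
      refine ⟨m, (x - chooseSum n (m + 1)) / n.choose (m + 1), div_nonneg (by linarith) hc.le,
        (div_le_one hc).2 (by linarith), ?_⟩
      rw [div_mul_cancel₀ _ hc.ne']
      ring

lemma ballGrowth_succ_le (n : ℕ) {x₀ x₁ : ℝ} (h1 : 1 ≤ x₀) (hx1 : 0 ≤ x₁) (hle : x₁ ≤ x₀)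
    (h2 : x₀ ≤ 2 ^ n) :
    ballGrowth (n + 1) (x₀ + x₁) ≤ ballGrowth n x₀ + max (ballGrowth n x₁) x₀ := by
  obtain ⟨k, α, h0, hα, hx⟩ := exists_chooseSum_interpolate (n + 1) (n + 1) (x := x₀ + x₁)
    (by linarith) (by rw [chooseSum_add_one_eq, pow_succ]; linarith)
  have hy₀ := ballGrowth_interpolate n (k + 1) h0 hα
  have hy₁ := ballGrowth_interpolate n k h0 hα
  rw [hx, ballGrowth_interpolate _ _ h0 hα]
  -- Pascal's rule splits an interpolated ball of `Q_(n+1)` into balls of `Q_n` with consecutive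
  -- radii and the same `α`; in particular `ballGrowth n y₁ = y₀`.
  set y₀ := chooseSum n (k + 1) + α * n.choose (k + 1)
  set y₁ := chooseSum n k + α * n.choose k with hy1
  have hsum : x₀ + x₁ = y₀ + y₁ := by
    rw [hx, chooseSum_succ_succ, Nat.choose_succ_succ, hy1]
    push_cast
    ring
  have hF : chooseSum (n + 1) (k + 1 + 1) + α * (n + 1).choose (k + 1 + 1) =
      ballGrowth n y₀ + ballGrowth n y₁ := by
    rw [hy₀, hy₁, chooseSum_succ_succ, Nat.choose_succ_succ]
    push_cast
    ring
  rw [hF]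
  -- If `x₀ ≥ y₀`, monotonicity and `x₀ ≥ ballGrowth n y₁` suffice; otherwise `x₀, x₁` lie between
  -- `y₁` and `y₀`, and concavity applies.
  rcases le_or_gt y₀ x₀ with h | h
  · have := ballGrowth_mono n h
    have := le_max_right (ballGrowth n x₁) x₀
    linarith
  · have := (ballGrowth_concaveOn n).add_le_add_of_spread hsum (by linarith) (by linarith)
    have := le_max_left (ballGrowth n x₁) x₀
    linarith

/-! ### Vertex isoperimetry by induction on the dimension. -/

/-- The subsets of `S` at Hamming distance at most one from the family `𝒜`. -/
def closedNeighbors {V : Type*} [DecidableEq V] (S : Finset V) (𝒜 : Finset (Finset V)) :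
    Finset (Finset V) :=
  S.powerset.filter fun x => ∃ y ∈ 𝒜, (x ∆ y).card ≤ 1

lemma insert_symmDiff_insert {V : Type*} [DecidableEq V] {a : V} {x y : Finset V}
    (hx : a ∉ x) (hy : a ∉ y) : insert a x ∆ insert a y = x ∆ y := by
  ext b
  by_cases hb : b = a
  · subst hb
    simp [Finset.mem_symmDiff, hx, hy]
  · simp [Finset.mem_symmDiff, hb]

lemma insert_symmDiff_self {V : Type*} [DecidableEq V] {a : V} {x : Finset V}
    (hx : a ∉ x) : insert a x ∆ x = {a} := by
  ext b
  by_cases hb : b = a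
  · subst hb
    simp [Finset.mem_symmDiff, hx]
  · simp [Finset.mem_symmDiff, hb]

/-- In each half of the cube, the neighbourhood contains both that of the family's part in this half
and a copy of its part in the other half. -/
lemma card_closedNeighbors_insert {V : Type*} [DecidableEq V] {a : V} {S : Finset V}
    (ha : a ∉ S) {𝒜 : Finset (Finset V)} (h𝒜 : 𝒜 ⊆ (insert a S).powerset) :
    max (closedNeighbors S (𝒜.nonMemberSubfamily a)).card (𝒜.memberSubfamily a).card +
      max (closedNeighbors S (𝒜.memberSubfamily a)).card (𝒜.nonMemberSubfamily a).card ≤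
      (closedNeighbors (insert a S) 𝒜).card := by
  have hsub {x : Finset V} (hx : x ∈ 𝒜) : x ⊆ insert a S := Finset.mem_powerset.1 (h𝒜 hx)
  have hnot {x : Finset V} (hx : x ⊆ S) : a ∉ x := fun h => ha (hx h)
  rw [← Finset.card_memberSubfamily_add_card_nonMemberSubfamily a
    (closedNeighbors (insert a S) 𝒜), add_comm]
  refine add_le_add (max_le ?_ ?_) (max_le ?_ ?_) <;> refine Finset.card_le_card fun x hx => ?_ <;>
    simp only [closedNeighbors, Finset.mem_memberSubfamily, Finset.mem_nonMemberSubfamily,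
      Finset.mem_filter, Finset.mem_powerset] at hx ⊢
  · obtain ⟨hxS, y, ⟨hy, hay⟩, hxy⟩ := hx
    exact ⟨⟨Finset.insert_subset_insert _ hxS, _, hy,
      by rwa [insert_symmDiff_insert (hnot hxS) hay]⟩, hnot hxS⟩
  · exact ⟨⟨Finset.insert_subset_insert _
      ((Finset.subset_insert_iff_of_notMem hx.2).1 (hsub hx.1)), x, hx.1,
      by rw [insert_symmDiff_self hx.2]; simp⟩, hx.2⟩
  · obtain ⟨hxS, y, ⟨hy, hay⟩, hxy⟩ := hx
    exact ⟨⟨hxS.trans (Finset.subset_insert _ _), _, hy, hxy⟩, hnot hxS⟩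
  · exact ⟨⟨(Finset.subset_insert _ _).trans (hsub hx.1), _, hx.1,
      by rw [symmDiff_comm, insert_symmDiff_self hx.2]; simp⟩, hx.2⟩

/-- A piecewise affine form of Harper's vertex-isoperimetric inequality in the hypercube. -/
theorem ballGrowth_card_le_card_closedNeighbors {V : Type*} [DecidableEq V] (S : Finset V)
    {𝒜 : Finset (Finset V)} (h𝒜 : 𝒜 ⊆ S.powerset) (hne : 𝒜.Nonempty) :
    ballGrowth S.card 𝒜.card ≤ (closedNeighbors S 𝒜).card := by
  induction S using Finset.induction_on generalizing 𝒜 with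
  | empty =>
    obtain rfl : 𝒜 = {∅} := by
      rw [Finset.powerset_empty] at h𝒜
      exact (Finset.Nonempty.subset_singleton_iff hne).1 h𝒜
    have hN : closedNeighbors (∅ : Finset V) {∅} = {∅} := by
      ext x
      simp only [closedNeighbors, Finset.mem_filter, Finset.powerset_empty, Finset.mem_singleton,
        exists_eq_left, and_iff_left_iff_imp]
      rintro rfl
      simp
    have := ballGrowth_interpolate 0 0 zero_le_one le_rfl
    simp [chooseSum] at this
    simp [hN, this]
  | insert a S ha ih =>
    have hcard := card_closedNeighbors_insert ha h𝒜
    have hsum := Finset.card_memberSubfamily_add_card_nonMemberSubfamily a 𝒜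
    have hm : 𝒜.memberSubfamily a ⊆ S.powerset := fun x hx => by
      rw [Finset.mem_memberSubfamily] at hx
      have := Finset.mem_powerset.1 (h𝒜 hx.1)
      rw [Finset.mem_powerset]
      exact (Finset.insert_subset_insert_iff hx.2).1 this
    have hn : 𝒜.nonMemberSubfamily a ⊆ S.powerset := fun x hx => by
      rw [Finset.mem_nonMemberSubfamily] at hx
      have := Finset.mem_powerset.1 (h𝒜 hx.1)
      rw [Finset.mem_powerset]
      exact (Finset.subset_insert_iff_of_notMem hx.2).1 this
    have key : ∀ 𝒳 𝒴 : Finset (Finset V), 𝒳 ⊆ S.powerset → 𝒴 ⊆ S.powerset →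
        𝒴.card ≤ 𝒳.card → 𝒳.card + 𝒴.card = 𝒜.card →
        max (closedNeighbors S 𝒳).card 𝒴.card + max (closedNeighbors S 𝒴).card 𝒳.card ≤
          (closedNeighbors (insert a S) 𝒜).card →
        ballGrowth (insert a S).card 𝒜.card ≤ (closedNeighbors (insert a S) 𝒜).card := by
      intro 𝒳 𝒴 hX hY hle hs hc
      have hpos : 1 ≤ 𝒳.card := by
        have := hne.card_pos
        omega
      have h1 : (1 : ℝ) ≤ 𝒳.card := by exact_mod_cast hpos
      have h2 : (𝒳.card : ℝ) ≤ 2 ^ S.card := by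
        exact_mod_cast (Finset.card_le_card hX).trans_eq (Finset.card_powerset S)
      have hb := ballGrowth_succ_le S.card h1 (Nat.cast_nonneg 𝒴.card) (by exact_mod_cast hle) h2
      have hXN := ih hX (Finset.card_pos.1 hpos)
      have hYN : max (ballGrowth S.card 𝒴.card) 𝒳.card ≤
          max ((closedNeighbors S 𝒴).card : ℝ) 𝒳.card := by
        -- An empty half has no neighbours although `ballGrowth` is 1 at 0; the term `𝒳.card ≥ 1`
        -- covers this.
        rcases 𝒴.eq_empty_or_nonempty with rfl | hYne
        · refine max_le (le_max_of_le_right ?_) (le_max_right _ _)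
          simpa [ballGrowth_zero] using h1
        · exact max_le_max (ih hY hYne) le_rfl
      have hc' : max ((closedNeighbors S 𝒳).card : ℝ) 𝒴.card +
          max ((closedNeighbors S 𝒴).card : ℝ) 𝒳.card ≤
            (closedNeighbors (insert a S) 𝒜).card := by exact_mod_cast hc
      have := le_max_left ((closedNeighbors S 𝒳).card : ℝ) 𝒴.card
      rw [Finset.card_insert_of_notMem ha, ← hs]
      push_cast
      linarith
    rcases le_total (𝒜.memberSubfamily a).card (𝒜.nonMemberSubfamily a).card with h | h
    · exact key _ _ hn hm h (by omega) hcard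
    · exact key _ _ hm hn h hsum (by omega)

/-! ### Hall's theorem with defect. -/

/-- The defect form of Hall's marriage theorem. -/
lemma exists_injOn_of_card_le_card_biUnion_add {V W : Type*} [DecidableEq V] [DecidableEq W]
    [Nonempty W] (A : Finset V)
    (N : V → Finset W) (d : ℕ)
    (h : ∀ X ⊆ A, X.card ≤ (X.biUnion N).card + d) :
    ∃ (B : Finset V) (f : V → W), B ⊆ A ∧ A.card ≤ B.card + d ∧ Set.InjOn f B ∧
      ∀ x ∈ B, f x ∈ N x := by
  classical
  -- Add `d` dummy partners available to every vertex; at most `d` vertices are matched to dummies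
  -- and then dropped.
  let t : A → Finset (W ⊕ Fin d) := fun x => (N x).disjSum Finset.univ
  have ht : ∀ s : Finset A, s.card ≤ (s.biUnion t).card := by
    intro s
    rcases s.eq_empty_or_nonempty with rfl | ⟨x₀, hx₀⟩
    · simp
    · have hX := h (s.map (Function.Embedding.subtype _)) (by
        intro x hx
        obtain ⟨y, _, rfl⟩ := Finset.mem_map.1 hx
        exact y.2)
      rw [Finset.card_map] at hX
      refine hX.trans ?_
      have : ((s.map (Function.Embedding.subtype _)).biUnion N).disjSum
          (Finset.univ : Finset (Fin d)) ⊆ s.biUnion t := by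
        intro w hw
        rw [Finset.mem_biUnion]
        rcases w with w | i
        · rw [Finset.inl_mem_disjSum, Finset.mem_biUnion] at hw
          obtain ⟨x, hx, hw⟩ := hw
          obtain ⟨y, hy, rfl⟩ := Finset.mem_map.1 hx
          exact ⟨y, hy, Finset.inl_mem_disjSum.2 hw⟩
        · exact ⟨x₀, hx₀, Finset.inr_mem_disjSum.2 (Finset.mem_univ _)⟩
      simpa using Finset.card_le_card this
  obtain ⟨g, hg, hgt⟩ := (Finset.all_card_le_biUnion_card_iff_exists_injective t).1 ht
  let P : Finset A := Finset.univ.filter fun x => (g x).isLeft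
  have hP : A.card ≤ P.card + d := by
    have hc := Finset.card_filter_add_card_filter_not (s := (Finset.univ : Finset A))
      (fun x => (g x).isLeft = true)
    rw [Finset.card_univ, Fintype.card_coe] at hc
    have hd : (Finset.univ.filter fun x : A => ¬ (g x).isLeft = true).card ≤ d := by
      have : (Finset.univ.filter fun x : A => ¬ (g x).isLeft = true).image g ⊆
          (∅ : Finset W).disjSum Finset.univ := by
        intro w hw
        obtain ⟨x, hx, rfl⟩ := Finset.mem_image.1 hw
        have hx := (Finset.mem_filter.1 hx).2
        rcases hgx : g x with w | i
        · simp [hgx] at hx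
        · simp
      have := Finset.card_le_card this
      rw [Finset.card_image_of_injective _ hg] at this
      simpa using this
    change A.card ≤ (Finset.univ.filter fun x : A => (g x).isLeft = true).card + d
    omega
  have w₀ : W := Classical.arbitrary W
  let f : V → W := fun x => if hx : x ∈ A then (g ⟨x, hx⟩).elim id (fun _ => w₀) else w₀
  have hf (x : A) (hx : x ∈ P) : g x = Sum.inl (f x) := by
    have hx := (Finset.mem_filter.1 hx).2
    rcases hgx : g x with w | i
    · simp [f, hgx]
    · simp [hgx] at hx
  refine ⟨P.map (Function.Embedding.subtype _), f, ?_, by simpa using hP, ?_, ?_⟩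
  · intro x hx
    obtain ⟨y, _, rfl⟩ := Finset.mem_map.1 hx
    exact y.2
  · intro x hx y hy hxy
    obtain ⟨x, hxP, rfl⟩ := Finset.mem_map.1 (Finset.mem_coe.1 hx)
    obtain ⟨y, hyP, rfl⟩ := Finset.mem_map.1 (Finset.mem_coe.1 hy)
    have : g x = g y := by
      rw [hf x hxP, hf y hyP]
      exact congrArg _ hxy
    rw [hg this]
  · intro x hx
    obtain ⟨x, hxP, rfl⟩ := Finset.mem_map.1 hx
    have := hgt x
    rw [hf x hxP] at this
    exact Finset.inl_mem_disjSum.1 this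

/-! ### Estimates for the surface size. -/

lemma exists_level {n : ℕ} {x : ℝ} (h1 : 1 ≤ x) (h2 : x < 2 ^ n) :
    ∃ (k : ℕ) (α : ℝ), k < n ∧ 0 ≤ α ∧ α < 1 ∧
      x = chooseSum n (k + 1) + α * n.choose (k + 1) ∧
      surfaceSize n x = (1 - α) * n.choose k + α * n.choose (k + 1) := by
  have hP0 : (ballSize n 0 : ℝ) ≤ x := by
    rwa [ballSize_eq_chooseSum, zero_add, chooseSum_one]
  have hk : (ballSize n (levelIndex n x) : ℝ) ≤ x :=
    Nat.findGreatest_spec (P := fun k => (ballSize n k : ℝ) ≤ x) (Nat.zero_le n) hP0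
  have hkn : levelIndex n x < n := by
    refine lt_of_le_of_ne (Nat.findGreatest_le n) fun h => ?_
    rw [h, ballSize_eq_chooseSum, chooseSum_add_one_eq] at hk
    linarith
  have hlt : x < ballSize n (levelIndex n x + 1) := not_le.1 <|
    Nat.findGreatest_is_greatest (P := fun k => (ballSize n k : ℝ) ≤ x)
      (Nat.lt_succ_self (levelIndex n x)) hkn
  have hc : (0 : ℝ) < n.choose (levelIndex n x + 1) := by
    exact_mod_cast Nat.choose_pos hkn
  rw [ballSize_eq_chooseSum, chooseSum_succ, ← ballSize_eq_chooseSum] at hlt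
  refine ⟨levelIndex n x, levelFraction n x, hkn, div_nonneg (by linarith) hc.le,
    (div_lt_one hc).2 (by linarith), ?_, ?_⟩
  · rw [levelFraction, div_mul_cancel₀ _ hc.ne', ballSize_eq_chooseSum]
    ring
  · rw [surfaceSize, if_neg (by linarith)]

lemma interpolate_choose_le_succ {n k : ℕ} (hk : k < n) {α : ℝ} (h0 : 0 ≤ α) (h1 : α ≤ 1)
    (h : 2 * (chooseSum n (k + 1) + α * n.choose (k + 1)) ≤ 2 ^ n) :
    (1 - α) * n.choose k + α * n.choose (k + 1) ≤
      (1 - α) * n.choose (k + 1) + α * n.choose (k + 1 + 1) := by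
  have hsym := chooseSum_add_chooseSum n (k + 1) (by omega)
  have hpos (i : ℕ) (hi : i ≤ n) : (0 : ℝ) < n.choose i := by exact_mod_cast Nat.choose_pos hi
  have hmono (i : ℕ) (hi : 2 * i + 1 ≤ n) : (n.choose i : ℝ) ≤ n.choose (i + 1) := by
    rw [choose_succ_eq_mul_chooseRatio]
    refine le_mul_of_one_le_right (Nat.cast_nonneg _) ?_
    have hi' : 2 * (i : ℝ) + 1 ≤ n := by exact_mod_cast hi
    rw [chooseRatio, le_sub_iff_add_le, le_div_iff₀ (by positivity)]
    linarith
  have hαc : 0 ≤ α * n.choose (k + 1) := by positivity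
  rcases lt_or_ge n (2 * k + 3) with hn | hn
  -- Near the middle level: `n = 2k + 2` forces `α ≤ 1/2`, `n = 2k + 1` forces `α = 0`, and for `n ≤
  -- 2k` the ball already exceeds half the cube.
  · rcases (show n = 2 * k + 2 ∨ n = 2 * k + 1 ∨ n ≤ 2 * k by omega) with rfl | rfl | hn
    · rw [show 2 * k + 2 + 1 - (k + 1) = k + 1 + 1 by omega, chooseSum_succ _ (k + 1)] at hsym
      have hα : 2 * α ≤ 1 := by
        have := hpos (k + 1) (by omega)
        by_contra! hcon
        have := mul_lt_mul_of_pos_right hcon this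
        linarith
      have hs : (2 * k + 2).choose (k + 1 + 1) = (2 * k + 2).choose k := by
        rw [← Nat.choose_symm (by omega)]
        congr 1
        omega
      rw [hs]
      have := mul_nonneg (sub_nonneg.2 hα) (sub_nonneg.2 (hmono k (by omega)))
      linarith
    · rw [show 2 * k + 1 + 1 - (k + 1) = k + 1 by omega] at hsym
      have hα : α = 0 := by
        have hp := hpos (k + 1) (by omega)
        have : α * ((2 * k + 1).choose (k + 1) : ℕ) = 0 := le_antisymm (by linarith) hαc
        exact (mul_eq_zero.1 this).resolve_right hp.ne'
      have := hmono k (by omega)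
      simpa [hα] using this
    · have := chooseSum_mono n (show n + 1 - (k + 1) ≤ k by omega)
      have hp := hpos k hk.le
      rw [chooseSum_succ n k] at h hsym
      linarith
  · have ha := mul_le_mul_of_nonneg_left (hmono k (by omega)) (sub_nonneg.2 h1)
    have hb := mul_le_mul_of_nonneg_left (hmono (k + 1) (by omega)) h0
    linarith

lemma surfaceSize_le_self {n : ℕ} {a : ℝ} (ha1 : 1 ≤ a) (ha : a < 2 ^ n) :
    surfaceSize n a ≤ a := by
  obtain ⟨k, α, hk, h0, h1, ha, hs⟩ := exists_level ha1 ha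
  have h := chooseSum_nonneg n k
  have h' : 0 ≤ α * n.choose k := by positivity
  rw [chooseSum_succ] at ha
  linarith

lemma surfaceSize_le_max {n : ℕ} {a x : ℝ} (ha1 : 1 ≤ a) (ha : 2 * a ≤ 2 ^ n) (hx : x ≤ a) :
    surfaceSize n a ≤ max (a - x) (ballGrowth n x - x) := by
  obtain ⟨k, α, hk, h0, h1, rfl, hs⟩ := exists_level ha1 (by linarith)
  have hle := interpolate_choose_le_succ hk h0 h1.le ha
  have hb := ballGrowth_interpolate n k h0 h1.le
  have ha' := ballGrowth_interpolate n (k + 1) h0 h1.le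
  rw [hs]
  have h1' := chooseSum_succ n k
  have h2' := chooseSum_succ n (k + 1)
  set a := chooseSum n (k + 1) + α * n.choose (k + 1)
  set b := chooseSum n k + α * n.choose k
  rcases le_or_gt x b with hxb | hxb
  · refine le_max_of_le_left ?_
    simp only [a, b] at hxb ⊢
    linarith
  · refine le_max_of_le_right ?_
    have hc : ConcaveOn ℝ Set.univ fun y => ballGrowth n y - y :=
      (ballGrowth_concaveOn n).sub (convexOn_id convex_univ)
    have hseg : x ∈ segment ℝ b a := by
      rw [segment_eq_Icc (hxb.le.trans hx)]
      exact ⟨hxb.le, hx⟩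
    refine le_trans (le_min ?_ ?_)
      (hc.ge_on_segment (Set.mem_univ b) (Set.mem_univ a) hseg)
    · rw [hb]
      simp only [b]
      linarith
    · rw [ha']
      simp only [a]
      linarith

/-! ### Construction of the matching. -/

/-- An injection along edges from a set to the complement of a larger set gives a matching. -/
lemma exists_isMatching_of_injOn {V : Type*} [Fintype V] [DecidableEq V] {G : SimpleGraph V}
    {A B : Finset V} (hB : B ⊆ A) {f : V → V} (hf : Set.InjOn f B)
    (hadj : ∀ x ∈ B, G.Adj x (f x) ∧ f x ∉ A) :
    ∃ M : G.Subgraph, M.IsMatching ∧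
      (∀ x y, M.Adj x y → (x ∈ A ∧ y ∈ Aᶜ) ∨ (x ∈ Aᶜ ∧ y ∈ A)) ∧
      B.card ≤ M.edgeSet.ncard := by
  let M : G.Subgraph :=
    { verts := {x | x ∈ B ∨ ∃ y ∈ B, f y = x}
      Adj := fun x y => (x ∈ B ∧ f x = y) ∨ (y ∈ B ∧ f y = x)
      adj_sub := by
        rintro x y (⟨hx, rfl⟩ | ⟨hy, rfl⟩)
        · exact (hadj x hx).1
        · exact (hadj y hy).1.symm
      edge_vert := by
        rintro x y (⟨hx, rfl⟩ | ⟨hy, rfl⟩)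
        · exact Or.inl hx
        · exact Or.inr ⟨y, hy, rfl⟩
      symm := ⟨fun x y h => h.symm⟩ }
  have hnot {x : V} (hx : x ∈ B) : f x ∉ B := fun h => (hadj x hx).2 (hB h)
  refine ⟨M, ?_, ?_, ?_⟩
  · rintro x (hx | ⟨y, hy, rfl⟩)
    · refine ⟨f x, Or.inl ⟨hx, rfl⟩, ?_⟩
      rintro z (⟨-, rfl⟩ | ⟨hz, rfl⟩)
      · rfl
      · exact absurd hx (hnot hz)
    · refine ⟨y, Or.inr ⟨hy, rfl⟩, ?_⟩
      rintro z (⟨hz, -⟩ | ⟨hz, h⟩)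
      · exact absurd hz (hnot hy)
      · exact hf hz hy h
  · rintro x y (⟨hx, rfl⟩ | ⟨hy, rfl⟩)
    · exact Or.inl ⟨hB hx, Finset.mem_compl.2 (hadj x hx).2⟩
    · exact Or.inr ⟨Finset.mem_compl.2 (hadj y hy).2, hB hy⟩
  · have hinj : Set.InjOn (fun x => s(x, f x)) (B : Set V) := by
      intro x hx y hy hxy
      rcases Sym2.eq_iff.1 hxy with ⟨h, -⟩ | ⟨h, -⟩
      · exact h
      · exact absurd (h ▸ Finset.mem_coe.1 hx) (hnot hy)
    rw [← Set.ncard_coe_finset B, ← hinj.ncard_image]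
    refine Set.ncard_le_ncard ?_ (Set.toFinite _)
    rintro _ ⟨x, hx, rfl⟩
    exact Or.inl ⟨hx, rfl⟩

theorem mainTheorem7 (n : ℕ) (A : Finset (Finset (Fin n))) (hA : 2 * A.card ≤ 2 ^ n) :
    ∃ M : (hypercube n).Subgraph,
      M.IsMatching ∧
      (∀ x y, M.Adj x y → (x ∈ A ∧ y ∈ Aᶜ) ∨ (x ∈ Aᶜ ∧ y ∈ A)) ∧
      surfaceSize n (A.card : ℝ) ≤ (M.edgeSet.ncard : ℝ) := by
  rcases A.eq_empty_or_nonempty with rfl | hne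
  · exact ⟨⊥, by simp [SimpleGraph.Subgraph.IsMatching], by simp, by simp [surfaceSize]⟩
  have ha1 : (1 : ℝ) ≤ A.card := by exact_mod_cast hne.card_pos
  have ha2 : 2 * (A.card : ℝ) ≤ 2 ^ n := by exact_mod_cast hA
  have hsA : surfaceSize n A.card ≤ A.card := surfaceSize_le_self ha1 (by linarith)
  set m := ⌈surfaceSize n A.card⌉₊ with hm
  let N : Finset (Fin n) → Finset (Finset (Fin n)) := fun x =>
    Finset.univ.filter fun y => (x ∆ y).card = 1 ∧ y ∉ A
  have hHall : ∀ X ⊆ A, X.card ≤ (X.biUnion N).card + (A.card - m) := by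
    intro X hX
    have hXA := Finset.card_le_card hX
    suffices h : m ≤ (A.card - X.card) + (X.biUnion N).card by omega
    rw [hm, Nat.ceil_le]
    push_cast [Nat.cast_sub hXA]
    -- The isoperimetric bound fails for empty `X`; there `s(a) ≤ a` is enough.
    rcases X.eq_empty_or_nonempty with rfl | hXne
    · simpa using hsA
    have hF := ballGrowth_card_le_card_closedNeighbors Finset.univ (𝒜 := X) (by simp) hXne
    rw [Finset.card_univ, Fintype.card_fin] at hF
    have hsub : closedNeighbors Finset.univ X ⊆ A ∪ X.biUnion N := by
      intro x hx
      obtain ⟨-, y, hy, hyx⟩ := Finset.mem_filter.1 hx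
      by_cases hxA : x ∈ A
      · exact Finset.mem_union_left _ hxA
      refine Finset.mem_union_right _ (Finset.mem_biUnion.2 ⟨y, hy, Finset.mem_filter.2
        ⟨Finset.mem_univ _, le_antisymm (by rwa [symmDiff_comm]) ?_, hxA⟩⟩)
      rw [Nat.one_le_iff_ne_zero, Ne, Finset.card_eq_zero, ← Finset.bot_eq_empty,
        symmDiff_eq_bot]
      rintro rfl
      exact hxA (hX hy)
    have hc : ((closedNeighbors Finset.univ X).card : ℝ) ≤ A.card + (X.biUnion N).card := by
      exact_mod_cast (Finset.card_le_card hsub).trans (Finset.card_union_le _ _)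
    have := surfaceSize_le_max ha1 ha2 (x := X.card) (by exact_mod_cast hXA)
    refine this.trans (max_le ?_ ?_)
    · exact le_add_of_nonneg_right (Nat.cast_nonneg _)
    · linarith
  obtain ⟨B, f, hBA, hBc, hf, hfN⟩ := exists_injOn_of_card_le_card_biUnion_add A N _ hHall
  obtain ⟨M, hM, hMA, hMc⟩ := exists_isMatching_of_injOn (G := hypercube n) hBA hf
    fun x hx => (Finset.mem_filter.1 (hfN x hx)).2
  have hmA : m ≤ A.card := Nat.ceil_le.2 hsA
  refine ⟨M, hM, hMA, (Nat.le_ceil _).trans ?_⟩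
  exact_mod_cast (show m ≤ B.card by omega).trans hMc
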